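/- Let $L\ge 1$, let $2=r_1>r_2>\dots>r_{L+1}=1$, let $\mu_1,\dots,\mu_L$ and $\epsilon_1,\dots,\epsilon_L$ be positive numbers, and set $\mu_0=\epsilon_0=1$ (permeabilities and permittivities of a layered structure surrounding the perfectly conducting ball $|x|<1$; layer $j$ is $r_{j+1}\le|x|<r_j$). For a frequency $t>0$ put $k_j=t\sqrt{\epsilon_j\mu_j}$. Let $j_n$ and $y_n$ be the spherical Bessel functions of the first and second kind, $h_n=j_n+iy_n$ the spherical Hankel function of the first kind, $\mathcal J_n(s)=j_n(s)+s\,j_n'(s)$ and $\mathcal H_n(s)=h_n(s)+s\,h_n'(s)$. Let $p_{n,2}^{TE}(t)$ and $p_{n,2}^{TM}(t)$ be the entries in the first row and second column of $$P_n^{TE}(t)=(-it)^L\Big(\prod_{j=1}^L\mu_j^{3/2}\epsilon_j^{1/2}r_j\Big)\begin{bmatrix} j_n(k_L)&h_n(k_L)\\0&0\end{bmatrix}M^{TE}_L M^{TE}_{L-1}\cdots M^{TE}_1,$$ $$P_n^{TM}(t)=(it)^L\Big(\prod_{j=1}^L\mu_j^{1/2}\epsilon_j^{3/2}r_j\Big)\begin{bmatrix}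 \mathcal J_n(k_L)&\mathcal H_n(k_L)\\0&0\end{bmatrix}M^{TM}_L M^{TM}_{L-1}\cdots M^{TM}_1,$$ where $$M^{TE}_j=\begin{bmatrix}\frac1{\mu_j}\mathcal H_n(k_jr_j)&-h_n(k_jr_j)\\-\frac1{\mu_j}\mathcal J_n(k_jr_j)&j_n(k_jr_j)\end{bmatrix}\begin{bmatrix}j_n(k_{j-1}r_j)&h_n(k_{j-1}r_j)\\\frac1{\mu_{j-1}}\mathcal J_n(k_{j-1}r_j)&\frac1{\mu_{j-1}}\mathcal H_n(k_{j-1}r_j)\end{bmatrix},$$ $$M^{TM}_j=\begin{bmatrix}h_n(k_jr_j)&-\frac1{\epsilon_j}\mathcal H_n(k_jr_j)\\-j_n(k_jr_j)&\frac1{\epsilon_j}\mathcal J_n(k_jr_j)\end{bmatrix}\begin{bmatrix}\frac1{\epsilon_{j-1}}\mathcal J_n(k_{j-1}r_j)&\frac1{\epsilon_{j-1}}\mathcal H_n(k_{j-1}r_j)\\j_n(k_{j-1}r_j)&h_n(k_{j-1}r_j)\end{bmatrix}.$$ Then for every $n\ge1$ and for each of the two polarizations $T\in\{TE,TM\}$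 the leading low-frequency coefficient $g_{n,0}^{T}$ of $p_{n,2}^{T}$ exists and is nonzero. That is, there is a number $g_{n,0}^{T}$ with $p_{n,2}^{T}(t)=t^{-n-1}\big(g_{n,0}^{T}+o(1)\big)$ as $t\to0^+$; and whenever, for some $N\ge n$ and complex numbers $g_{n,0}^T,\dots,g_{n,N-n}^T$, $$p_{n,2}^{T}(t)=t^{-n-1}\Big(\sum_{l=0}^{N-n}g_{n,l}^{T}\,t^{2l}+o(t^{2N-2n})\Big)\qquad(t\to0^+),$$ one has $g_{n,0}^{T}\ne0$. -/

import Mathlib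

open Filter Topology Asymptotics
open scoped Nat

noncomputable section

/-- Spherical Bessel function of the first kind
`j_n(t) = ∑ (-1)^l t^(n+2l) / (2^l l! · 1·3⋯(2n+2l+1))`. -/
def sphJ (n : ℕ) (t : ℝ) : ℝ :=
  ∑' l : ℕ, (-1) ^ l * t ^ (n + 2 * l) / (2 ^ l * (l ! : ℝ) * ((2 * n + 2 * l + 1)‼ : ℝ))

/-- Spherical Bessel function of the second kind
`y_n(t) = -(2n)!/(2^n n!) ∑ (-1)^l t^(2l-n-1) / (2^l l! (-2n+1)(-2n+3)⋯(-2n+2l-1))`. -/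
def sphY (n : ℕ) (t : ℝ) : ℝ :=
  -(((2 * n)! : ℝ) / (2 ^ n * (n ! : ℝ))) *
    ∑' l : ℕ, (-1) ^ l * t ^ (2 * (l : ℤ) - (n : ℤ) - 1) /
      (2 ^ l * (l ! : ℝ) * ∏ i ∈ Finset.range l, (-2 * (n : ℝ) + 2 * (i : ℝ) + 1))

/-- Spherical Hankel function of the first kind, `h_n^{(1)} = j_n + i y_n`. -/
def sphH (n : ℕ) (t : ℝ) : ℂ := (sphJ n t : ℂ) + Complex.I * (sphY n t : ℂ)

/-- `𝒥_n(t) = j_n(t) + t j_n'(t)`. -/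
def calJ (n : ℕ) (t : ℝ) : ℝ := sphJ n t + t * deriv (sphJ n) t

/-- `ℋ_n(t) = h_n^{(1)}(t) + t (h_n^{(1)})'(t)`. -/
def calH (n : ℕ) (t : ℝ) : ℂ := sphH n t + (t : ℂ) * deriv (sphH n) t

/-- A layered medium with `L` layers: `2 = r_1 > r_2 > ⋯ > r_{L+1} = 1`, the layer
`r_{j+1} ≤ |x| < r_j` (`1 ≤ j ≤ L`) has permeability `μ_j > 0` and permittivity `ε_j > 0`,
and the exterior `|x| > 2` has `μ_0 = ε_0 = 1`. The core `|x| < 1` is perfectly conducting.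
Only the values `r 1, …, r (L+1)` and `μ 0, …, μ L`, `ε 0, …, ε L` matter. -/
structure IsLayered (L : ℕ) (r μ ε : ℕ → ℝ) : Prop where
  r_one : r 1 = 2
  r_last : r (L + 1) = 1
  r_lt : ∀ j, 1 ≤ j → j ≤ L → r (j + 1) < r j
  mu_zero : μ 0 = 1
  eps_zero : ε 0 = 1
  mu_pos : ∀ j, 1 ≤ j → j ≤ L → 0 < μ j
  eps_pos : ∀ j, 1 ≤ j → j ≤ L → 0 < ε j

/-- Wave number `k_j = t √(ε_j μ_j)` of layer `j` at frequency `t`. -/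
def waveNum (μ ε : ℕ → ℝ) (t : ℝ) (j : ℕ) : ℝ := t * √(ε j * μ j)

/-- The product of the two matrices attached to the interface `|x| = r_j` in `P_n^{TE}`. -/
def interfaceTE (n : ℕ) (r μ ε : ℕ → ℝ) (t : ℝ) (j : ℕ) : Matrix (Fin 2) (Fin 2) ℂ :=
  let x : ℝ := waveNum μ ε t j * r j
  let y : ℝ := waveNum μ ε t (j - 1) * r j
  !![calH n x / (μ j : ℂ), -sphH n x;
     -((calJ n x : ℂ) / (μ j : ℂ)), (sphJ n x : ℂ)] *
  !![(sphJ n y : ℂ), sphH n y;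
     (calJ n y : ℂ) / (μ (j - 1) : ℂ), calH n y / (μ (j - 1) : ℂ)]

/-- The product of the two matrices attached to the interface `|x| = r_j` in `P_n^{TM}`. -/
def interfaceTM (n : ℕ) (r μ ε : ℕ → ℝ) (t : ℝ) (j : ℕ) : Matrix (Fin 2) (Fin 2) ℂ :=
  let x : ℝ := waveNum μ ε t j * r j
  let y : ℝ := waveNum μ ε t (j - 1) * r j
  !![sphH n x, -(calH n x / (ε j : ℂ));
     -(sphJ n x : ℂ), (calJ n x : ℂ) / (ε j : ℂ)] *
  !![(calJ n y : ℂ) / (ε (j - 1) : ℂ), calH n y / (ε (j - 1) : ℂ);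
     (sphJ n y : ℂ), sphH n y]

/-- Ordered product `M_L * M_{L-1} * ⋯ * M_1`. -/
def orderedProd (M : ℕ → Matrix (Fin 2) (Fin 2) ℂ) : ℕ → Matrix (Fin 2) (Fin 2) ℂ
  | 0 => 1
  | j + 1 => M (j + 1) * orderedProd M j

/-- The matrix `P_n^{TE}[ε, μ, t]`. -/
def PTE (n L : ℕ) (r μ ε : ℕ → ℝ) (t : ℝ) : Matrix (Fin 2) (Fin 2) ℂ :=
  ((-Complex.I * (t : ℂ)) ^ L *
      ((∏ j ∈ Finset.Icc 1 L, μ j ^ (3 / 2 : ℝ) * ε j ^ (1 / 2 : ℝ) * r j : ℝ) : ℂ)) •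
    (!![(sphJ n (waveNum μ ε t L) : ℂ), sphH n (waveNum μ ε t L); 0, 0] *
      orderedProd (interfaceTE n r μ ε t) L)

/-- The matrix `P_n^{TM}[ε, μ, t]`. -/
def PTM (n L : ℕ) (r μ ε : ℕ → ℝ) (t : ℝ) : Matrix (Fin 2) (Fin 2) ℂ :=
  ((Complex.I * (t : ℂ)) ^ L *
      ((∏ j ∈ Finset.Icc 1 L, μ j ^ (1 / 2 : ℝ) * ε j ^ (3 / 2 : ℝ) * r j : ℝ) : ℂ)) •
    (!![(calJ n (waveNum μ ε t L) : ℂ), calH n (waveNum μ ε t L); 0, 0] *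
      orderedProd (interfaceTM n r μ ε t) L)

/-- `p_{n,2}^{TE}`, the entry of `P_n^{TE}` in the first row and second column. -/
def pTE2 (n L : ℕ) (r μ ε : ℕ → ℝ) (t : ℝ) : ℂ := PTE n L r μ ε t 0 1

/-- `p_{n,2}^{TM}`, the entry of `P_n^{TM}` in the first row and second column. -/
def pTM2 (n L : ℕ) (r μ ε : ℕ → ℝ) (t : ℝ) : ℂ := PTM n L r μ ε t 0 1

/-- The low-frequency expansion of order `N ≥ n`,
`p(t) = t^(-n-1) (∑_{l=0}^{N-n} g_l t^(2l) + o(t^(2N-2n)))` as `t → 0+`. -/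
def HasLowFreqExpansion (n N : ℕ) (p : ℝ → ℂ) (g : ℕ → ℂ) : Prop :=
  (fun t : ℝ => (t : ℂ) ^ (n + 1) * p t -
      ∑ l ∈ Finset.range (N - n + 1), g l * (t : ℂ) ^ (2 * l))
    =o[𝓝[>] 0] fun t : ℝ => t ^ (2 * (N - n))

end

/-!
The leading low-frequency coefficient is the trace on the core of a static (`t = 0`) field. Grouping
the factors of `P_n` by layers instead of interfaces, its second column is the trace of the outgoing
mode of the exterior medium, carried through each layer `r_{j+1} ≤ |x| < r_j` by
`W_j(k_j r_{j+1}) adj W_j(k_j r_j)`, where the columns of `W_j` are the tangential traces of the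
regular and the outgoing mode. With `s = t ξ` one has `W(s) = R(s) diag(s ^ n, s ^ (-n-1))` with
`R(s)` convergent at `0`, and
`t diag((t ζ) ^ n, (t ζ) ^ (-n-1)) adj diag((t ξ) ^ n, (t ξ) ^ (-n-1))` does not depend on `t`; so
`-i t W(t ζ) adj W(t ξ)` has a limit. That limit is a real matrix with positive diagonal and
nonpositive off-diagonal entries. Hence it preserves the opposite signs which, for `n ≥ 1`, the two
components of the static outgoing trace have at first, and neither can vanish on the core.
Exchanging `μ` and `ε` turns `TM` into `TE`, with the second component of the trace in place of the
first.
-/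

noncomputable section

section LeadingTerm

variable {E F : Type*} [NormedAddCommGroup E] [NormedSpace ℝ E]
  [NormedAddCommGroup F] [NormedSpace ℝ F]

/-- `f` is, near `0⁺`, the product of `s ^ m` and a function analytic at `0` with value `c` there;
`c = 0` is allowed, so that `m` need not be the exact order of `f`. -/
def HasLeadingTerm (f : ℝ → E) (m : ℤ) (c : E) : Prop :=
  ∃ G : ℝ → E, AnalyticAt ℝ G 0 ∧ G 0 = c ∧ ∀ᶠ s in 𝓝[>] 0, f s = s ^ m • G s

namespace HasLeadingTerm

variable {f g : ℝ → E} {m k : ℤ} {c d : E}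

theorem tendsto (hf : HasLeadingTerm f m c) :
    Tendsto (fun s => s ^ (-m) • f s) (𝓝[>] 0) (𝓝 c) := by
  obtain ⟨G, hG, rfl, hfG⟩ := hf
  refine (hG.continuousAt.tendsto.mono_left nhdsWithin_le_nhds).congr' ?_
  filter_upwards [hfG, self_mem_nhdsWithin] with s hs hs0
  rw [hs, smul_smul, ← zpow_add₀ (ne_of_gt hs0), neg_add_cancel, zpow_zero, one_smul]

theorem map (A : E →L[ℝ] F) (hf : HasLeadingTerm f m c) :
    HasLeadingTerm (fun s => A (f s)) m (A c) := by
  obtain ⟨G, hG, rfl, hfG⟩ := hf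
  refine ⟨fun s => A (G s), A.analyticAt _ |>.comp hG, rfl, ?_⟩
  filter_upwards [hfG] with s hs
  rw [hs, map_smul]

theorem add_of_lt (hf : HasLeadingTerm f m c) (hg : HasLeadingTerm g k d) (hmk : m < k) :
    HasLeadingTerm (fun s => f s + g s) m c := by
  obtain ⟨G, hG, rfl, hfG⟩ := hf
  obtain ⟨H, hH, -, hgH⟩ := hg
  obtain ⟨p, hp⟩ := Int.eq_ofNat_of_zero_le (sub_nonneg.2 hmk.le)
  have hp0 : p ≠ 0 := by omega
  refine ⟨fun s => G s + s ^ p • H s, hG.add ((analyticAt_id.pow p).smul hH), by simp [hp0], ?_⟩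
  filter_upwards [hfG, hgH, self_mem_nhdsWithin] with s hfs hgs hs0
  rw [hfs, hgs, smul_add, smul_smul, ← zpow_natCast, ← zpow_add₀ (ne_of_gt hs0), ← hp,
    add_sub_cancel]

theorem add_smul_deriv [CompleteSpace E] (hf : HasLeadingTerm f m c) :
    HasLeadingTerm (fun s => f s + s • deriv f s) m ((m + 1 : ℝ) • c) := by
  obtain ⟨G, hG, rfl, hfG⟩ := hf
  refine ⟨fun s => (m + 1 : ℝ) • G s + s • deriv G s,
    (analyticAt_const.smul hG).add (analyticAt_id.smul hG.deriv), by simp, ?_⟩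
  filter_upwards [eventually_eventually_nhdsWithin.2 hfG, self_mem_nhdsWithin,
    nhdsWithin_le_nhds hG.eventually_analyticAt] with s hfs hs0 hGs
  have hs : s ≠ 0 := ne_of_gt hs0
  rw [nhdsWithin_eq_nhds.2 (Ioi_mem_nhds hs0)] at hfs
  have hderiv : deriv f s = s ^ m • deriv G s + (m * s ^ (m - 1)) • G s :=
    (((hasDerivAt_zpow m s (Or.inl hs)).smul hGs.differentiableAt.hasDerivAt).congr_of_eventuallyEq
      hfs).deriv
  rw [hfs.self_of_nhds, hderiv, zpow_sub_one₀ hs]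
  match_scalars
  · field_simp
    ring
  · field_simp

end HasLeadingTerm

end LeadingTerm

section Bessel

theorem analyticAt_tsum_mul_pow {𝕜 : Type*} [NontriviallyNormedField 𝕜] [CompleteSpace 𝕜]
    {a : ℕ → 𝕜} {C : ℝ} (ha : ∀ l, ‖a l‖ ≤ C) :
    AnalyticAt 𝕜 (fun z => ∑' l, a l * z ^ l) 0 := by
  have hr : (1 : ENNReal) ≤ (FormalMultilinearSeries.ofScalars 𝕜 a).radius :=
    FormalMultilinearSeries.le_radius_of_bound _ C (r := 1) fun l => by
      simpa [FormalMultilinearSeries.ofScalars_norm] using ha l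
  have h := (FormalMultilinearSeries.hasFPowerSeriesOnBall _ (one_pos.trans_le hr)).analyticAt
  refine h.congr (Eventually.of_forall fun z => tsum_congr fun l => ?_)
  simp [mul_comm]

theorem hasLeadingTerm_tsum {d : ℕ → ℝ} (hd : ∀ l, 1 ≤ |d l|) (m : ℤ) :
    HasLeadingTerm (fun s : ℝ => ∑' l : ℕ, (-1) ^ l * s ^ (m + 2 * l) / (2 ^ l * (l ! : ℝ) * d l))
      m (d 0)⁻¹ := by
  set a : ℕ → ℝ := fun l => (-1) ^ l / (2 ^ l * (l ! : ℝ) * d l) with ha_def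
  have ha : ∀ l, ‖a l‖ ≤ 1 := fun l => by
    have h2 : (1 : ℝ) ≤ 2 ^ l := one_le_pow₀ one_le_two
    have h3 : (1 : ℝ) ≤ l ! := by exact_mod_cast l.factorial_pos
    have h := one_le_mul_of_one_le_of_one_le (one_le_mul_of_one_le_of_one_le h2 h3) (hd l)
    simpa [ha_def, abs_mul] using inv_le_one_of_one_le₀ h
  refine ⟨fun s => ∑' l, a l * (s ^ 2) ^ l, ?_, ?_, ?_⟩
  · exact (analyticAt_tsum_mul_pow ha).comp_of_eq (analyticAt_id.pow 2) (by simp)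
  · have h0 : ∑' l, a l * ((0 : ℝ) ^ 2) ^ l = a 0 * ((0 : ℝ) ^ 2) ^ 0 :=
      tsum_eq_single 0 fun l hl => by simp [hl]
    simpa [ha_def] using h0
  · filter_upwards [self_mem_nhdsWithin] with s hs
    rw [smul_eq_mul, ← tsum_mul_left]
    refine tsum_congr fun l => ?_
    rw [zpow_add₀ (ne_of_gt hs), ← pow_mul, ha_def]
    norm_cast
    ring

/-- The coefficient `1 / (2n+1)‼` in `j_n(s) ∼ s ^ n / (2n+1)‼`. -/
def sphJCoeff (n : ℕ) : ℝ := ((2 * n + 1)‼ : ℝ)⁻¹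

/-- The coefficient `(2n)! / (2ⁿ n!) = (2n-1)‼` in `y_n(s) ∼ -(2n-1)‼ / s ^ (n + 1)`. -/
def sphYCoeff (n : ℕ) : ℝ := (2 * n)! / (2 ^ n * n !)

theorem sphJCoeff_pos (n : ℕ) : 0 < sphJCoeff n :=
  inv_pos.2 (by exact_mod_cast Nat.doubleFactorial_pos _)

theorem sphYCoeff_pos (n : ℕ) : 0 < sphYCoeff n := by
  unfold sphYCoeff
  positivity

theorem hasLeadingTerm_sphJ (n : ℕ) : HasLeadingTerm (sphJ n) n (sphJCoeff n) := by
  have hd : ∀ l : ℕ, 1 ≤ |((2 * n + 2 * l + 1)‼ : ℝ)| := fun l => by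
    rw [Nat.abs_cast]
    exact_mod_cast Nat.doubleFactorial_pos _
  convert hasLeadingTerm_tsum hd n using 1
  · funext s
    simp only [sphJ]
    norm_cast
  · rfl

theorem one_le_abs_prod_odd (n l : ℕ) :
    1 ≤ |∏ i ∈ Finset.range l, (-2 * (n : ℝ) + 2 * (i : ℝ) + 1)| := by
  rw [Finset.abs_prod]
  refine Finset.one_le_prod fun i _ => ?_
  have : (1 : ℤ) ≤ |-2 * (n : ℤ) + 2 * (i : ℤ) + 1| := Int.one_le_abs (by omega)
  exact_mod_cast this

theorem hasLeadingTerm_sphY (n : ℕ) :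
    HasLeadingTerm (sphY n) (-(n + 1 : ℤ)) (-sphYCoeff n) := by
  have h := (hasLeadingTerm_tsum (one_le_abs_prod_odd n) (-(n + 1 : ℤ))).map
    (-sphYCoeff n • ContinuousLinearMap.id ℝ ℝ)
  convert h using 1
  · funext s
    simp only [sphY, sphYCoeff, smul_apply, ContinuousLinearMap.id_apply,
      smul_eq_mul]
    congr! 6 with l
    ring
  · simp

theorem hasLeadingTerm_sphH (n : ℕ) :
    HasLeadingTerm (sphH n) (-(n + 1 : ℤ)) (-Complex.I * sphYCoeff n) := by
  have hY := (hasLeadingTerm_sphY n).map (Complex.I • Complex.ofRealCLM)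
  have hJ := (hasLeadingTerm_sphJ n).map Complex.ofRealCLM
  convert hY.add_of_lt hJ (by omega) using 1
  · funext s
    simp [sphH, add_comm]
  · simp

theorem hasLeadingTerm_calJ (n : ℕ) :
    HasLeadingTerm (calJ n) n ((n + 1) * sphJCoeff n) :=
  (hasLeadingTerm_sphJ n).add_smul_deriv

theorem hasLeadingTerm_calH (n : ℕ) :
    HasLeadingTerm (calH n) (-(n + 1 : ℤ)) (Complex.I * (n * sphYCoeff n)) := by
  convert (hasLeadingTerm_sphH n).add_smul_deriv using 1
  · funext s
    rw [calH, Complex.real_smul]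
  · rw [Complex.real_smul]
    push_cast
    ring

end Bessel

section Transfer

theorem tendsto_mul_const_nhdsGT_zero {ξ : ℝ} (hξ : 0 < ξ) :
    Tendsto (fun t : ℝ => t * ξ) (𝓝[>] 0) (𝓝[>] 0) := by
  refine tendsto_nhdsWithin_iff.2 ⟨?_, ?_⟩
  · simpa using ((continuous_mul_const ξ).tendsto 0).mono_left nhdsWithin_le_nhds
  · filter_upwards [self_mem_nhdsWithin] with t ht using mul_pos ht hξ

/-- The tangential traces `(j_n, h_n)` and `(𝒥_n / m, ℋ_n / m)` of the regular and the outgoing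
mode at the argument `s`, in a medium with coefficient `m`. -/
def modeTrace (n : ℕ) (m s : ℝ) : Matrix (Fin 2) (Fin 2) ℂ :=
  !![(sphJ n s : ℂ), sphH n s; (calJ n s : ℂ) / (m : ℂ), calH n s / (m : ℂ)]

/-- The orders `s ^ n` of the regular and `s ^ (-n-1)` of the outgoing mode at `s = 0`. -/
def modeScaling (n : ℕ) (s : ℝ) : Matrix (Fin 2) (Fin 2) ℂ :=
  !![(s : ℂ) ^ n, 0; 0, (s : ℂ)⁻¹ ^ (n + 1)]

/-- The leading coefficients at `s = 0` of the entries of `modeTrace n m s`. -/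
def staticModes (n : ℕ) (m : ℝ) : Matrix (Fin 2) (Fin 2) ℂ :=
  !![(sphJCoeff n : ℂ), -Complex.I * sphYCoeff n;
     (n + 1) * sphJCoeff n / m, Complex.I * (n * sphYCoeff n) / m]

/-- The matrix carrying the static (`t = 0`) trace from `|x| = ξ` to `|x| = ζ`, both radii being
measured in units of `t / k`. -/
def staticTransfer (n : ℕ) (m ζ ξ : ℝ) : Matrix (Fin 2) (Fin 2) ℝ :=
  let X := ζ ^ n / ξ ^ (n + 1)
  let Z := ξ ^ n / ζ ^ (n + 1)
  (sphJCoeff n * sphYCoeff n) •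
    !![(n * X + (n + 1) * Z) / m, X - Z; n * (n + 1) * (X - Z) / m ^ 2, ((n + 1) * X + n * Z) / m]

theorem modeScaling_inv_mul_cancel (n : ℕ) {s : ℝ} (hs : s ≠ 0) :
    modeScaling n s⁻¹ * modeScaling n s = 1 := by
  have hs' : (s : ℂ) ≠ 0 := by exact_mod_cast hs
  simp [modeScaling, Matrix.one_fin_two, hs']

theorem smul_modeScaling_mul_adjugate (n : ℕ) {t : ℝ} (ht : t ≠ 0) (ζ ξ : ℝ) :
    (t : ℂ) • (modeScaling n (t * ζ) * (modeScaling n (t * ξ)).adjugate) =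
      !![(ζ : ℂ) ^ n / ξ ^ (n + 1), 0; 0, (ξ : ℂ) ^ n / ζ ^ (n + 1)] := by
  have ht' : (t : ℂ) ≠ 0 := by exact_mod_cast ht
  rw [modeScaling, modeScaling, Matrix.adjugate_fin_two_of, Matrix.mul_fin_two]
  ext i k
  fin_cases i <;> fin_cases k <;>
    simp only [Fin.zero_eta, Fin.mk_one, Matrix.smul_apply, Matrix.of_apply, Matrix.cons_val',
      Matrix.cons_val, smul_eq_mul, Complex.ofReal_mul, mul_pow, mul_inv, inv_pow] <;>
    field_simp <;> ring

theorem tendsto_modeTrace_mul_modeScaling_inv (n : ℕ) (m : ℝ) :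
    Tendsto (fun s => modeTrace n m s * modeScaling n s⁻¹) (𝓝[>] 0) (𝓝 (staticModes n m)) := by
  have hj : Tendsto (fun s : ℝ => (s : ℂ)⁻¹ ^ n * sphJ n s) (𝓝[>] 0) (𝓝 (sphJCoeff n)) := by
    simpa using ((hasLeadingTerm_sphJ n).map Complex.ofRealCLM).tendsto
  have hJ : Tendsto (fun s : ℝ => (s : ℂ)⁻¹ ^ n * calJ n s) (𝓝[>] 0)
      (𝓝 ((n + 1) * sphJCoeff n)) := by
    simpa using ((hasLeadingTerm_calJ n).map Complex.ofRealCLM).tendsto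
  have hh : Tendsto (fun s : ℝ => (s : ℂ) ^ (n + 1) * sphH n s) (𝓝[>] 0)
      (𝓝 (-Complex.I * sphYCoeff n)) :=
    (hasLeadingTerm_sphH n).tendsto.congr fun s => by
      rw [neg_neg, Complex.real_smul]
      norm_cast
  have hH : Tendsto (fun s : ℝ => (s : ℂ) ^ (n + 1) * calH n s) (𝓝[>] 0)
      (𝓝 (Complex.I * (n * sphYCoeff n))) :=
    (hasLeadingTerm_calH n).tendsto.congr fun s => by
      rw [neg_neg, Complex.real_smul]
      norm_cast
  have hcols : ∀ s : ℝ, modeTrace n m s * modeScaling n s⁻¹ =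
      !![(s : ℂ)⁻¹ ^ n * sphJ n s, (s : ℂ) ^ (n + 1) * sphH n s;
         (s : ℂ)⁻¹ ^ n * calJ n s / m, (s : ℂ) ^ (n + 1) * calH n s / m] := fun s => by
    simp [modeTrace, modeScaling, mul_comm, div_mul_eq_mul_div]
  refine tendsto_pi_nhds.2 fun i => tendsto_pi_nhds.2 fun k => ?_
  simp only [hcols]
  fin_cases i <;> fin_cases k
  exacts [hj, hh, hJ.div_const _, hH.div_const _]

theorem staticModes_mul_diagonal_mul_adjugate (n : ℕ) (m ζ ξ : ℝ) :
    staticModes n m * !![(ζ : ℂ) ^ n / ξ ^ (n + 1), 0; 0, (ξ : ℂ) ^ n / ζ ^ (n + 1)] *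
        (staticModes n m).adjugate =
      Complex.I • (staticTransfer n m ζ ξ).map (↑) := by
  rw [staticModes, Matrix.adjugate_fin_two_of, Matrix.mul_fin_two, Matrix.mul_fin_two,
    staticTransfer]
  ext i k
  fin_cases i <;> fin_cases k <;>
    simp only [Fin.zero_eta, Fin.mk_one, Matrix.smul_apply, Matrix.map_apply, Matrix.of_apply,
      Matrix.cons_val', Matrix.cons_val, smul_eq_mul] <;>
    push_cast <;> ring

theorem tendsto_modeTrace_mul_adjugate (n : ℕ) (m : ℝ) {ζ ξ : ℝ} (hζ : 0 < ζ) (hξ : 0 < ξ) :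
    Tendsto (fun t : ℝ => (-Complex.I * t) •
      (modeTrace n m (t * ζ) * (modeTrace n m (t * ξ)).adjugate))
      (𝓝[>] 0) (𝓝 ((staticTransfer n m ζ ξ).map (↑))) := by
  obtain ⟨R, hR, hfactor⟩ : ∃ R : ℝ → Matrix (Fin 2) (Fin 2) ℂ,
      Tendsto R (𝓝[>] 0) (𝓝 (staticModes n m)) ∧
        ∀ s ≠ 0, modeTrace n m s = R s * modeScaling n s :=
    ⟨_, tendsto_modeTrace_mul_modeScaling_inv n m, fun s hs => by
      rw [mul_assoc, modeScaling_inv_mul_cancel n hs, mul_one]⟩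
  have hadj : Tendsto (fun t => (R (t * ξ)).adjugate) (𝓝[>] 0) (𝓝 (staticModes n m).adjugate) :=
    ((continuous_id.matrix_adjugate).tendsto _).comp
      (hR.comp (tendsto_mul_const_nhdsGT_zero hξ))
  have h := (((hR.comp (tendsto_mul_const_nhdsGT_zero hζ)).mul_const
    !![(ζ : ℂ) ^ n / ξ ^ (n + 1), 0; 0, (ξ : ℂ) ^ n / ζ ^ (n + 1)]).mul hadj).const_smul
      (-Complex.I)
  rw [staticModes_mul_diagonal_mul_adjugate, smul_smul, neg_mul, Complex.I_mul_I, neg_neg,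
    one_smul] at h
  refine h.congr' ?_
  filter_upwards [self_mem_nhdsWithin] with t ht
  have ht0 : t ≠ 0 := ne_of_gt ht
  rw [hfactor _ (mul_ne_zero ht0 hζ.ne'), hfactor _ (mul_ne_zero ht0 hξ.ne'),
    Matrix.adjugate_mul_distrib, ← smul_modeScaling_mul_adjugate n ht0]
  simp only [Function.comp, Matrix.mul_smul, Matrix.smul_mul, smul_smul, mul_assoc]

end Transfer

section LowFrequency

theorem hasLowFreqExpansion_self_iff {n : ℕ} {p : ℝ → ℂ} {g : ℕ → ℂ} :
    HasLowFreqExpansion n n p g ↔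
      Tendsto (fun t : ℝ => (t : ℂ) ^ (n + 1) * p t) (𝓝[>] 0) (𝓝 (g 0)) := by
  rw [← tendsto_sub_nhds_zero_iff, ← isLittleO_one_iff ℝ]
  simp [HasLowFreqExpansion]

theorem HasLowFreqExpansion.tendsto {n N : ℕ} {p : ℝ → ℂ} {g : ℕ → ℂ}
    (h : HasLowFreqExpansion n N p g) :
    Tendsto (fun t : ℝ => (t : ℂ) ^ (n + 1) * p t) (𝓝[>] 0) (𝓝 (g 0)) := by
  have hpow : Tendsto (fun t : ℝ => t ^ (2 * (N - n))) (𝓝[>] 0) (𝓝 (0 ^ (2 * (N - n)))) :=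
    ((continuous_pow _).tendsto 0).mono_left nhdsWithin_le_nhds
  have hrem := (isLittleO_one_iff ℝ).1 (h.trans_isBigO (hpow.isBigO_one ℝ))
  have hcont : Continuous fun t : ℝ => ∑ l ∈ Finset.range (N - n + 1), g l * (t : ℂ) ^ (2 * l) := by
    fun_prop
  have hsum := hrem.add ((hcont.tendsto 0).mono_left nhdsWithin_le_nhds)
  simpa [Finset.sum_range_succ'] using hsum

theorem lowFreqExpansion_of_tendsto {n : ℕ} {p : ℝ → ℂ} {c : ℂ} (hc : c ≠ 0)
    (h : Tendsto (fun t : ℝ => (t : ℂ) ^ (n + 1) * p t) (𝓝[>] 0) (𝓝 c)) :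
    (∃ g : ℕ → ℂ, HasLowFreqExpansion n n p g) ∧
      ∀ (N : ℕ) (g : ℕ → ℂ), n ≤ N → HasLowFreqExpansion n N p g → g 0 ≠ 0 :=
  ⟨⟨fun _ => c, hasLowFreqExpansion_self_iff.2 h⟩,
    fun _ _ _ hg => tendsto_nhds_unique h hg.tendsto ▸ hc⟩

end LowFrequency

section Layers

theorem tendsto_mulVec {α m n R : Type*} [Fintype n] [NonUnitalNonAssocSemiring R]
    [TopologicalSpace R] [ContinuousAdd R] [ContinuousMul R] {l : Filter α} {A : α → Matrix m n R}
    {B : Matrix m n R} {v : α → n → R} {w : n → R} (hA : Tendsto A l (𝓝 B))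
    (hv : Tendsto v l (𝓝 w)) : Tendsto (fun a => (A a).mulVec (v a)) l (𝓝 (B.mulVec w)) := by
  have hcont : Continuous fun p : Matrix m n R × (n → R) => p.1.mulVec p.2 :=
    continuous_fst.matrix_mulVec continuous_snd
  exact (hcont.tendsto (B, w)).comp (hA.prodMk_nhds hv)

theorem interfaceTE_eq (n : ℕ) (r μ ε : ℕ → ℝ) (t : ℝ) (j : ℕ) :
    interfaceTE n r μ ε t j =
      (modeTrace n (μ j) (waveNum μ ε t j * r j)).adjugate *
        modeTrace n (μ (j - 1)) (waveNum μ ε t (j - 1) * r j) := by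
  rw [modeTrace, Matrix.adjugate_fin_two_of]
  rfl

theorem waveNum_swap (μ ε : ℕ → ℝ) : waveNum ε μ = waveNum μ ε := by
  funext t j
  rw [waveNum, waveNum, mul_comm (μ j)]

theorem interfaceTM_eq_neg_interfaceTE (n : ℕ) (r μ ε : ℕ → ℝ) (t : ℝ) :
    interfaceTM n r μ ε t = -interfaceTE n r ε μ t := by
  funext j
  simp only [interfaceTM, interfaceTE, waveNum_swap, Pi.neg_apply]
  ext i k
  fin_cases i <;> fin_cases k <;> simp

theorem orderedProd_neg (M : ℕ → Matrix (Fin 2) (Fin 2) ℂ) (L : ℕ) :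
    orderedProd (-M) L = (-1 : ℂ) ^ L • orderedProd M L := by
  induction L with
  | zero => simp [orderedProd]
  | succ L ih =>
    rw [orderedProd, orderedProd, ih, Pi.neg_apply, pow_succ, mul_neg_one, neg_smul, neg_mul,
      Matrix.mul_smul]

/-- The `TE` trace on the inner boundary `|x| = r (j + 1)` of layer `j` of the outgoing mode
prescribed in the exterior medium. -/
def outgoingTrace (n : ℕ) (r μ ε : ℕ → ℝ) (t : ℝ) (j : ℕ) : Fin 2 → ℂ :=
  (modeTrace n (μ j) (waveNum μ ε t j * r (j + 1)) * orderedProd (interfaceTE n r μ ε t) j).mulVec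
    ![0, 1]

/-- The static limit of `outgoingTrace`, up to the factor `-i (-it) ^ (-j) t ^ (-n-1)`. -/
def staticTrace (n : ℕ) (r μ ε : ℕ → ℝ) : ℕ → Fin 2 → ℝ
  | 0 => (sphYCoeff n / (√(ε 0 * μ 0) * r 1) ^ (n + 1)) • ![1, -n / μ 0]
  | j + 1 => (staticTransfer n (μ (j + 1)) (√(ε (j + 1) * μ (j + 1)) * r (j + 2))
      (√(ε (j + 1) * μ (j + 1)) * r (j + 1))).mulVec (staticTrace n r μ ε j)

theorem outgoingTrace_succ (n : ℕ) (r μ ε : ℕ → ℝ) (t : ℝ) (j : ℕ) :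
    outgoingTrace n r μ ε t (j + 1) =
      (modeTrace n (μ (j + 1)) (waveNum μ ε t (j + 1) * r (j + 2)) *
        (modeTrace n (μ (j + 1)) (waveNum μ ε t (j + 1) * r (j + 1))).adjugate).mulVec
          (outgoingTrace n r μ ε t j) := by
  rw [outgoingTrace, outgoingTrace, orderedProd, interfaceTE_eq, Matrix.mulVec_mulVec,
    Nat.add_sub_cancel]
  simp only [mul_assoc]

theorem tendsto_outgoingTrace_zero (n : ℕ) {r μ ε : ℕ → ℝ} (hκ : 0 < ε 0 * μ 0) (hr : 0 < r 1) :
    Tendsto (fun t : ℝ => (t : ℂ) ^ (n + 1) • outgoingTrace n r μ ε t 0) (𝓝[>] 0)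
      (𝓝 (-Complex.I • fun i => (staticTrace n r μ ε 0 i : ℂ))) := by
  set ξ := √(ε 0 * μ 0) * r 1 with hξ_def
  have hξ : 0 < ξ := mul_pos (Real.sqrt_pos.2 hκ) hr
  have hξ' : (ξ : ℂ) ≠ 0 := by exact_mod_cast hξ.ne'
  have h := tendsto_mulVec ((tendsto_modeTrace_mul_modeScaling_inv n (μ 0)).comp
    (tendsto_mul_const_nhdsGT_zero hξ)) (tendsto_const_nhds (x := ![0, ((ξ : ℂ) ^ (n + 1))⁻¹]))
  have hscale : ∀ t : ℝ, (modeScaling n (t * ξ)⁻¹).mulVec ![0, ((ξ : ℂ) ^ (n + 1))⁻¹] =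
      (t : ℂ) ^ (n + 1) • ![0, 1] := fun t => by
    ext i
    fin_cases i <;> simp [modeScaling, mul_pow, mul_left_comm, hξ']
  convert h.congr fun t => ?_ using 2
  · ext i
    fin_cases i <;>
      simp only [Fin.zero_eta, Fin.mk_one, staticTrace, staticModes, ← hξ_def, Pi.smul_apply,
        smul_eq_mul, Matrix.mulVec, dotProduct, Fin.sum_univ_two, Matrix.of_apply, Matrix.cons_val',
        Matrix.cons_val] <;>
      push_cast <;> ring
  · rw [outgoingTrace, orderedProd, mul_one, waveNum, mul_assoc, ← hξ_def, ← Matrix.mulVec_smul,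
      ← hscale, Matrix.mulVec_mulVec]
    rfl

theorem tendsto_outgoingTrace (n : ℕ) {r μ ε : ℕ → ℝ} {L : ℕ} (hκ : ∀ j ≤ L, 0 < ε j * μ j)
    (hr : ∀ j ≤ L, 0 < r (j + 1)) :
    Tendsto (fun t : ℝ => ((-Complex.I * t) ^ L * t ^ (n + 1)) • outgoingTrace n r μ ε t L)
      (𝓝[>] 0) (𝓝 (-Complex.I • fun i => (staticTrace n r μ ε L i : ℂ))) := by
  induction L with
  | zero => simpa using tendsto_outgoingTrace_zero n (hκ 0 le_rfl) (hr 0 le_rfl)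
  | succ L ih =>
    have hs := Real.sqrt_pos.2 (hκ (L + 1) le_rfl)
    have hT := tendsto_modeTrace_mul_adjugate n (μ (L + 1)) (mul_pos hs (hr (L + 1) le_rfl))
      (mul_pos hs (hr L L.le_succ))
    have hv := ih (fun j hj => hκ j (hj.trans L.le_succ)) (fun j hj => hr j (hj.trans L.le_succ))
    convert (tendsto_mulVec hT hv).congr fun t => ?_ using 2
    · rw [Matrix.mulVec_smul, staticTrace]
      congr 1
      exact funext fun i => RingHom.map_mulVec Complex.ofRealHom _ _ i
    · rw [outgoingTrace_succ, Matrix.smul_mulVec, Matrix.mulVec_smul, smul_smul, pow_succ' _ L]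
      simp only [waveNum, mul_assoc]

theorem staticTransfer_signs (n : ℕ) {m ζ ξ : ℝ} (hm : 0 < m) (hζ : 0 < ζ) (hζξ : ζ ≤ ξ) :
    0 < staticTransfer n m ζ ξ 0 0 ∧ staticTransfer n m ζ ξ 0 1 ≤ 0 ∧
      staticTransfer n m ζ ξ 1 0 ≤ 0 ∧ 0 < staticTransfer n m ζ ξ 1 1 := by
  have hξ : 0 < ξ := hζ.trans_le hζξ
  have hXZ : ζ ^ n / ξ ^ (n + 1) ≤ ξ ^ n / ζ ^ (n + 1) := by gcongr
  have hc : 0 < sphJCoeff n * sphYCoeff n := mul_pos (sphJCoeff_pos n) (sphYCoeff_pos n)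
  refine ⟨mul_pos hc ?_, mul_nonpos_of_nonneg_of_nonpos hc.le (sub_nonpos.2 hXZ),
    mul_nonpos_of_nonneg_of_nonpos hc.le ?_, mul_pos hc ?_⟩
  · change 0 < (n * (ζ ^ n / ξ ^ (n + 1)) + (n + 1) * (ξ ^ n / ζ ^ (n + 1))) / m
    positivity
  · exact div_nonpos_of_nonpos_of_nonneg
      (mul_nonpos_of_nonneg_of_nonpos (by positivity) (sub_nonpos.2 hXZ)) (by positivity)
  · change 0 < ((n + 1) * (ζ ^ n / ξ ^ (n + 1)) + n * (ξ ^ n / ζ ^ (n + 1))) / m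
    positivity

theorem staticTrace_signs (n : ℕ) {r μ ε : ℕ → ℝ} {L : ℕ} (hμ : ∀ j ≤ L, 0 < μ j)
    (hε : ∀ j ≤ L, 0 < ε j) (hr : ∀ j ≤ L, 0 < r (j + 1))
    (hr' : ∀ j < L, r (j + 2) ≤ r (j + 1)) :
    0 < staticTrace n r μ ε L 0 ∧ staticTrace n r μ ε L 1 ≤ 0 ∧
      (1 ≤ n → staticTrace n r μ ε L 1 < 0) := by
  induction L with
  | zero =>
    have hμ0 := hμ 0 le_rfl
    have hc : 0 < sphYCoeff n / (√(ε 0 * μ 0) * r 1) ^ (n + 1) :=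
      div_pos (sphYCoeff_pos n) (pow_pos (mul_pos
        (Real.sqrt_pos.2 (mul_pos (hε 0 le_rfl) hμ0)) (hr 0 le_rfl)) _)
    refine ⟨mul_pos hc one_pos, mul_nonpos_of_nonneg_of_nonpos hc.le ?_,
      fun hn => mul_neg_of_pos_of_neg hc ?_⟩
    · exact div_nonpos_of_nonpos_of_nonneg (neg_nonpos.2 n.cast_nonneg) hμ0.le
    · exact div_neg_of_neg_of_pos (neg_neg_of_pos (by exact_mod_cast hn)) hμ0
  | succ L ih =>
    obtain ⟨h0, h1, h1'⟩ := ih (fun j hj => hμ j (by omega)) (fun j hj => hε j (by omega))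
      (fun j hj => hr j (by omega)) (fun j hj => hr' j (by omega))
    have hs := Real.sqrt_pos.2 (mul_pos (hε (L + 1) le_rfl) (hμ (L + 1) le_rfl))
    obtain ⟨h00, h01, h10, h11⟩ := staticTransfer_signs n (hμ (L + 1) le_rfl)
      (mul_pos hs (hr (L + 1) le_rfl))
      (mul_le_mul_of_nonneg_left (hr' L L.lt_succ_self) hs.le)
    simp only [staticTrace, Matrix.mulVec, dotProduct, Fin.sum_univ_two]
    exact ⟨add_pos_of_pos_of_nonneg (mul_pos h00 h0) (mul_nonneg_of_nonpos_of_nonpos h01 h1),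
      add_nonpos (mul_nonpos_of_nonpos_of_nonneg h10 h0.le)
        (mul_nonpos_of_nonneg_of_nonpos h11.le h1),
      fun hn => add_neg_of_nonpos_of_neg (mul_nonpos_of_nonpos_of_nonneg h10 h0.le)
        (mul_neg_of_pos_of_neg h11 (h1' hn))⟩

theorem outgoingTrace_apply (n : ℕ) (r μ ε : ℕ → ℝ) (t : ℝ) (j : ℕ) (i : Fin 2) :
    outgoingTrace n r μ ε t j i =
      modeTrace n (μ j) (waveNum μ ε t j * r (j + 1)) i 0 *
          orderedProd (interfaceTE n r μ ε t) j 0 1 +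
        modeTrace n (μ j) (waveNum μ ε t j * r (j + 1)) i 1 *
          orderedProd (interfaceTE n r μ ε t) j 1 1 := by
  simp [outgoingTrace, Matrix.mulVec, dotProduct, Matrix.mul_apply]

theorem pTE2_eq {n L : ℕ} {r μ ε : ℕ → ℝ} (hlast : r (L + 1) = 1) (t : ℝ) :
    pTE2 n L r μ ε t = (-Complex.I * t) ^ L *
      ((∏ j ∈ Finset.Icc 1 L, μ j ^ (3 / 2 : ℝ) * ε j ^ (1 / 2 : ℝ) * r j : ℝ) : ℂ) *
        outgoingTrace n r μ ε t L 0 := by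
  rw [pTE2, PTE, Matrix.smul_apply, Matrix.mul_apply, Fin.sum_univ_two, outgoingTrace_apply, hlast,
    mul_one]
  rfl

theorem pTM2_eq {n L : ℕ} {r μ ε : ℕ → ℝ} (hlast : r (L + 1) = 1) (hε : ε L ≠ 0) (t : ℝ) :
    pTM2 n L r μ ε t = (-Complex.I * t) ^ L *
      (((∏ j ∈ Finset.Icc 1 L, μ j ^ (1 / 2 : ℝ) * ε j ^ (3 / 2 : ℝ) * r j) * ε L : ℝ) : ℂ) *
        outgoingTrace n r ε μ t L 1 := by
  have hε' : (ε L : ℂ) ≠ 0 := by exact_mod_cast hε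
  have hsign : (Complex.I * t) ^ L * (-1 : ℂ) ^ L = (-Complex.I * t) ^ L := by
    rw [← mul_pow, mul_neg_one, neg_mul]
  rw [pTM2, PTM, interfaceTM_eq_neg_interfaceTE, orderedProd_neg, Matrix.mul_smul, smul_smul,
    mul_right_comm, hsign, Matrix.smul_apply, Matrix.mul_apply, Fin.sum_univ_two,
    outgoingTrace_apply, hlast, mul_one, waveNum_swap μ ε, smul_eq_mul,
    Complex.ofReal_mul _ (ε L), ← mul_assoc, mul_assoc _ (ε L : ℂ)]
  congr 1
  simp only [modeTrace, Matrix.of_apply, Matrix.cons_val_zero, Matrix.cons_val_one]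
  field_simp

theorem prod_layers_pos {r μ ε : ℕ → ℝ} {L : ℕ} (hμ : ∀ j ≤ L, 0 < μ j) (hε : ∀ j ≤ L, 0 < ε j)
    (hr : ∀ j ≤ L, 0 < r (j + 1)) (a b : ℝ) :
    0 < ∏ j ∈ Finset.Icc 1 L, μ j ^ a * ε j ^ b * r j := by
  refine Finset.prod_pos fun j hj => ?_
  obtain ⟨h1, hL⟩ := Finset.mem_Icc.1 hj
  have hrj : 0 < r (j - 1 + 1) := hr (j - 1) (by omega)
  rw [Nat.sub_add_cancel h1] at hrj
  exact mul_pos (mul_pos (Real.rpow_pos_of_pos (hμ j hL) a) (Real.rpow_pos_of_pos (hε j hL) b)) hrj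

theorem lowFreqExpansion_of_eq_mul_outgoingTrace {n L : ℕ} {r μ ε : ℕ → ℝ}
    (hκ : ∀ j ≤ L, 0 < ε j * μ j) (hr : ∀ j ≤ L, 0 < r (j + 1)) {p : ℝ → ℂ} {c : ℝ} (hc : c ≠ 0)
    {i : Fin 2} (hi : staticTrace n r μ ε L i ≠ 0)
    (hp : ∀ t : ℝ, p t = (-Complex.I * t) ^ L * c * outgoingTrace n r μ ε t L i) :
    (∃ g : ℕ → ℂ, HasLowFreqExpansion n n p g) ∧
      ∀ (N : ℕ) (g : ℕ → ℂ), n ≤ N → HasLowFreqExpansion n N p g → g 0 ≠ 0 := by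
  have hlim : Tendsto (fun t : ℝ => (t : ℂ) ^ (n + 1) * p t) (𝓝[>] 0)
      (𝓝 (c * (-Complex.I * staticTrace n r μ ε L i))) :=
    (((tendsto_outgoingTrace n hκ hr).apply_nhds i).const_mul (c : ℂ)).congr fun t => by
      simp only [hp, Pi.smul_apply, smul_eq_mul]
      ring
  exact lowFreqExpansion_of_tendsto (by simp [hc, hi]) hlim

end Layers

namespace IsLayered

variable {L : ℕ} {r μ ε : ℕ → ℝ}

theorem mu_pos_of_le (h : IsLayered L r μ ε) : ∀ j ≤ L, 0 < μ j
  | 0, _ => h.mu_zero ▸ one_pos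
  | j + 1, hj => h.mu_pos (j + 1) j.succ_pos hj

theorem eps_pos_of_le (h : IsLayered L r μ ε) : ∀ j ≤ L, 0 < ε j
  | 0, _ => h.eps_zero ▸ one_pos
  | j + 1, hj => h.eps_pos (j + 1) j.succ_pos hj

end IsLayered

end

theorem lemma4p1_general (L : ℕ) (r μ ε : ℕ → ℝ) (hμ : ∀ j ≤ L, 0 < μ j)
    (hε : ∀ j ≤ L, 0 < ε j) (hr : ∀ j, 1 ≤ j → j ≤ L → r (j + 1) ≤ r j)
    (hlast : r (L + 1) = 1) (n : ℕ) :
    ((∃ g : ℕ → ℂ, HasLowFreqExpansion n n (pTE2 n L r μ ε) g) ∧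
      ∀ (N : ℕ) (g : ℕ → ℂ), n ≤ N →
        HasLowFreqExpansion n N (pTE2 n L r μ ε) g → g 0 ≠ 0) ∧
    (1 ≤ n → (∃ g : ℕ → ℂ, HasLowFreqExpansion n n (pTM2 n L r μ ε) g) ∧
      ∀ (N : ℕ) (g : ℕ → ℂ), n ≤ N →
        HasLowFreqExpansion n N (pTM2 n L r μ ε) g → g 0 ≠ 0) := by
  have hmono : ∀ j < L, r (j + 2) ≤ r (j + 1) := fun j hj => hr (j + 1) j.succ_pos hj
  have hpos : ∀ j ≤ L, 0 < r (j + 1) := fun j hj => by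
    induction hj using Nat.decreasingInduction with
    | self => exact hlast ▸ one_pos
    | of_succ k hk ih => exact ih.trans_le (hmono k hk)
  have hκ : ∀ j ≤ L, 0 < ε j * μ j := fun j hj => mul_pos (hε j hj) (hμ j hj)
  have hκ' : ∀ j ≤ L, 0 < μ j * ε j := fun j hj => mul_pos (hμ j hj) (hε j hj)
  have hprod := prod_layers_pos hμ hε hpos
  refine ⟨lowFreqExpansion_of_eq_mul_outgoingTrace hκ hpos (hprod _ _).ne'
      (staticTrace_signs n hμ hε hpos hmono).1.ne' (pTE2_eq hlast), fun hn =>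
    lowFreqExpansion_of_eq_mul_outgoingTrace hκ' hpos
      (mul_pos (hprod _ _) (hε L le_rfl)).ne'
      ((staticTrace_signs n hε hμ hpos hmono).2.2 hn).ne (pTM2_eq hlast (hε L le_rfl).ne')⟩

theorem lemma4p1 (L : ℕ) (r μ ε : ℕ → ℝ) (hlay : IsLayered L r μ ε) (n : ℕ) (hn : 1 ≤ n) :
    ((∃ g : ℕ → ℂ, HasLowFreqExpansion n n (pTE2 n L r μ ε) g) ∧
      ∀ (N : ℕ) (g : ℕ → ℂ), n ≤ N →
        HasLowFreqExpansion n N (pTE2 n L r μ ε) g → g 0 ≠ 0) ∧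
    ((∃ g : ℕ → ℂ, HasLowFreqExpansion n n (pTM2 n L r μ ε) g) ∧
      ∀ (N : ℕ) (g : ℕ → ℂ), n ≤ N →
        HasLowFreqExpansion n N (pTM2 n L r μ ε) g → g 0 ≠ 0) :=
  (lemma4p1_general L r μ ε hlay.mu_pos_of_le hlay.eps_pos_of_le
    (fun j h1 hL => (hlay.r_lt j h1 hL).le) hlay.r_last n).imp_right fun h => h hn
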